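/- Conventions. Graphs are simple and of arbitrary cardinality. A Hamming graph is a Cartesian product of (possibly infinitely many, possibly infinite) complete graphs: two vertices are adjacent if and only if they differ in exactly one coordinate. A graph morphism sends the two ends of an edge to adjacent or equal vertices. A subgraph $Y$ of a graph $H$ is a retract of $H$ if some graph morphism $H \to Y$ restricts to the identity on $Y$. A connected graph is quasi-median if it is (isomorphic to) a retract of a Hamming graph. Let $X$ be a quasi-median graph. A hyperplane of $X$ is an equivalence class of edges for the reflexive-transitive closure of the relation that identifies two edges whenever they belong to a common $3$-cycle or are opposite in some induced $4$-cycle. A sector is a connected component of the graph obtained from $X$ by removing all the edges of some hyperplane. Two pairs of vertices $(a,b)$ and $(x,y)$ are parallel if, for every sector $S$, one has $a \in S$ and $b \notin S$ if and only if $x \in S$ and $y \notin S$. A subgraph $Y \subset X$ is gated if, for every vertex $x$ of $X$, there is a unique vertex $y \in V(Y)$ such that $x$ can be connected to any vertex of $Y$ by a geodesic of $X$ passing through $y$. For a collection $\mathcal{P}$ of subgraphs of $X$, $\mathrm{ConeOff}(X,\mathcal{P})$ is the graph obtained from $X$ by adding an edge between any two distinct vertices that belong to a common member of $\mathcal{P}$.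 The collection $\mathcal{P}$ is syllabic if any two vertices of $X$ are connected by some geodesic $\gamma$ of $\mathrm{ConeOff}(X,\mathcal{P})$ that extends to a geodesic of $X$, i.e. such that some geodesic of $X$ is obtained by connecting the successive vertices of $\gamma$ by geodesics of $X$. Proposition. Let $X$ be a quasi-median graph and $\mathcal{P}$ a collection of gated subgraphs of $X$. Assume that, for any two parallel pairs of vertices $(x,y)$ and $(a,b)$, if $x$ and $y$ both belong to some subgraph in $\mathcal{P}$, then $a$ and $b$ both belong to some subgraph in $\mathcal{P}$. Then the collection $\mathcal{P}$ is syllabic. -/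

import Mathlib

universe u

namespace QuasiMedian

variable {V : Type u}

/-- The Hamming graph `∏ j, K (κ j)`: the Cartesian product, over an arbitrary index type, of the
complete graphs on the types `κ j`. Two vertices are adjacent when they differ in exactly one
coordinate. -/
def hammingGraph {ι : Type u} (κ : ι → Type u) : SimpleGraph (∀ j, κ j) where
  Adj p q := ∃ j, p j ≠ q j ∧ ∀ k, k ≠ j → p k = q k
  symm := ⟨fun _ _ ⟨j, hj, h⟩ => ⟨j, hj.symm, fun k hk => (h k hk).symm⟩⟩
  loopless := ⟨fun _ ⟨_, hj, _⟩ => hj rfl⟩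

/-- `X` is (isomorphic to) a retract of `H`: there are a copy `i` of `X` in `H` and a graph
morphism `r` from `H` to `X` that is the identity on this copy. As usual for retracts of
Hamming graphs, a graph morphism sends the two ends of an edge to adjacent or equal vertices. -/
def IsRetractOf {W : Type u} (X : SimpleGraph V) (H : SimpleGraph W) : Prop :=
  ∃ (i : V → W) (r : W → V),
    (∀ u v, X.Adj u v → H.Adj (i u) (i v)) ∧
    (∀ p q, H.Adj p q → r p = r q ∨ X.Adj (r p) (r q)) ∧
    ∀ v, r (i v) = v

/-- A graph is quasi-median if it is connected and a retract of a Hamming graph. -/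
def IsQuasiMedian (X : SimpleGraph V) : Prop :=
  X.Connected ∧ ∃ (ι : Type u) (κ : ι → Type u), IsRetractOf X (hammingGraph κ)

/-- Two edges are elementarily equivalent if they belong to a common 3-cycle or are opposite in
some induced 4-cycle. -/
def EdgeRel (X : SimpleGraph V) (e f : Sym2 V) : Prop :=
  (∃ a b c, X.Adj a b ∧ X.Adj b c ∧ X.Adj c a ∧ e = s(a, b) ∧ f = s(b, c)) ∨
  (∃ a b c d, X.Adj a b ∧ X.Adj b c ∧ X.Adj c d ∧ X.Adj d a ∧
    a ≠ c ∧ b ≠ d ∧ ¬ X.Adj a c ∧ ¬ X.Adj b d ∧ e = s(a, b) ∧ f = s(c, d))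

/-- A hyperplane is the class of an edge for the reflexive-transitive closure of `EdgeRel`. -/
def IsHyperplane (X : SimpleGraph V) (J : Set (Sym2 V)) : Prop :=
  ∃ e ∈ X.edgeSet, J = {f | Relation.ReflTransGen (EdgeRel X) e f}

/-- A sector is (the vertex-set of) a connected component of the graph obtained from `X` by
removing the edges of some hyperplane. -/
def IsSector (X : SimpleGraph V) (S : Set V) : Prop :=
  ∃ J, IsHyperplane X J ∧ ∃ c : (X.deleteEdges J).ConnectedComponent, S = c.supp

/-- The pairs `(a, b)` and `(x, y)` are parallel: a sector contains `a` but not `b` if and only if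
it contains `x` but not `y`. -/
def Parallel (X : SimpleGraph V) (a b x y : V) : Prop :=
  ∀ S, IsSector X S → ((a ∈ S ∧ b ∉ S) ↔ (x ∈ S ∧ y ∉ S))

/-- A walk is a geodesic if its length is the distance between its ends. -/
def IsGeodesic {X : SimpleGraph V} {x y : V} (p : X.Walk x y) : Prop :=
  p.length = X.dist x y

/-- A subgraph `Y` is gated if every vertex `x` of `X` has a unique gate in `Y`: a vertex `y` of `Y`
such that `x` can be connected to any vertex of `Y` by a geodesic of `X` passing through `y`. -/
def IsGated {X : SimpleGraph V} (Y : X.Subgraph) : Prop :=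
  ∀ x : V, ∃! y : V, y ∈ Y.verts ∧
    ∀ z ∈ Y.verts, ∃ p : X.Walk x z, IsGeodesic p ∧ y ∈ p.support

/-- The cone-off: add to `X` an edge between any two distinct vertices lying in a common member of
the collection `𝓒` of vertex-sets. -/
def coneOff (X : SimpleGraph V) (𝓒 : Set (Set V)) : SimpleGraph V where
  Adj a b := X.Adj a b ∨ (a ≠ b ∧ ∃ P ∈ 𝓒, a ∈ P ∧ b ∈ P)
  symm := ⟨fun _ _ h => h.imp (fun h => h.symm)
    (fun ⟨hne, P, hP, ha, hb⟩ => ⟨hne.symm, P, hP, hb, ha⟩)⟩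
  loopless := ⟨fun _ h => h.elim (fun h => h.ne rfl) (fun h => h.1 rfl)⟩

/-- `Extends X γ δ`: the walk `δ` of `X` is obtained from the walk `γ` (in another graph `Z` with the
same vertices, such as a cone-off) by connecting successive vertices of `γ` by geodesics of `X`. -/
inductive Extends (X : SimpleGraph V) {Z : SimpleGraph V} :
    ∀ {x y : V}, Z.Walk x y → X.Walk x y → Prop
  | nil (x : V) : Extends X (SimpleGraph.Walk.nil : Z.Walk x x) (SimpleGraph.Walk.nil)
  | cons {x y z : V} (h : Z.Adj x y) (γ : Z.Walk y z) (p : X.Walk x y) (δ : X.Walk y z) :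
      IsGeodesic p → Extends X γ δ → Extends X (SimpleGraph.Walk.cons h γ) (p.append δ)

/-- A collection of subgraphs is syllabic if any two vertices are connected by a geodesic of the
cone-off (over the vertex-sets of these subgraphs) that extends to a geodesic of `X`. -/
def IsSyllabic (X : SimpleGraph V) (𝓒 : Set X.Subgraph) : Prop :=
  ∀ x y : V, ∃ γ : (coneOff X (SimpleGraph.Subgraph.verts '' 𝓒)).Walk x y, IsGeodesic γ ∧
    ∃ δ : X.Walk x y, Extends X γ δ ∧ IsGeodesic δ

end QuasiMedian

/-! View `X` as a retract of a Hamming graph: distances in `X` then count differing coordinates.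
Given `x` and `y`, let `φ u` have the coordinate of `y` wherever `u` agrees with `y`, and that of
`x` elsewhere. The key fact is that `X` is closed under this operation (`exists_dualDiscriminator`),
so `φ` maps `X` into the interval between `x` and `y` and fixes both ends. As `φ` acts
coordinatewise, it sends edges of the cone-off to edges or single vertices (`coneOff_eq_or_adj`);
gates and parallelism enter here. Hence the first step from `x` to `u` of a cone-off geodesic
towards `y` can be replaced by a step to `φ u`, which lies on a geodesic of `X` from `x` to `y`.
Induction on the cone-off distance concludes. -/

namespace QuasiMedian

variable {V : Type u} {X : SimpleGraph V} {ι : Type u} {κ : ι → Type u}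

/-- The set of coordinates at which two points of a product differ. -/
def diffSet (p q : ∀ j, κ j) : Set ι := {j | p j ≠ q j}

@[simp] lemma mem_diffSet {p q : ∀ j, κ j} {j : ι} : j ∈ diffSet p q ↔ p j ≠ q j := Iff.rfl

/-- A retraction of the Hamming graph `hammingGraph κ` onto a copy of the connected graph `X`. -/
structure HammingRetraction (X : SimpleGraph V) (κ : ι → Type u) where
  connected : X.Connected
  i : V → ∀ j, κ j
  r : (∀ j, κ j) → V
  adj_i : ∀ u v, X.Adj u v → (hammingGraph κ).Adj (i u) (i v)
  adj_r : ∀ p q, (hammingGraph κ).Adj p q → r p = r q ∨ X.Adj (r p) (r q)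
  r_i : ∀ v, r (i v) = v

/-! ### Distances in Hamming coordinates -/

lemma dist_add_dist_of_mem_support {x y z : V} {p : X.Walk x z} (hp : IsGeodesic p)
    (hy : y ∈ p.support) : X.dist x y + X.dist y z = X.dist x z := by
  classical
  have h1 := congrArg SimpleGraph.Walk.length (p.take_spec hy)
  rw [SimpleGraph.Walk.length_append, hp] at h1
  have h2 := SimpleGraph.dist_le (p.takeUntil y hy)
  have h3 := SimpleGraph.dist_le (p.dropUntil y hy)
  have h4 : X.dist x z ≤ X.dist x y + X.dist y z := by
    obtain ⟨a, ha⟩ := (p.takeUntil y hy).reachable.exists_walk_length_eq_dist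
    obtain ⟨b, hb⟩ := (p.dropUntil y hy).reachable.exists_walk_length_eq_dist
    rw [← ha, ← hb, ← SimpleGraph.Walk.length_append]
    exact SimpleGraph.dist_le _
  omega

namespace HammingRetraction

variable (R : HammingRetraction X κ)

lemma ext_i {a b : V} (h : ∀ j, R.i a j = R.i b j) : a = b := by
  rw [← R.r_i a, ← R.r_i b, funext h]

lemma eq_or_adj {a b : V} {j : ι} (h : ∀ k, k ≠ j → R.i a k = R.i b k) : a = b ∨ X.Adj a b := by
  by_cases hj : R.i a j = R.i b j
  · refine Or.inl (R.ext_i fun k => ?_)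
    by_cases hk : k = j
    · exact hk ▸ hj
    · exact h k hk
  · simpa only [R.r_i] using R.adj_r _ _ ⟨j, hj, h⟩

lemma diffSet_finite_and_ncard_le {a b : V} (p : X.Walk a b) :
    (diffSet (R.i a) (R.i b)).Finite ∧ (diffSet (R.i a) (R.i b)).ncard ≤ p.length := by
  induction p with
  | nil => simp [diffSet]
  | @cons a c b h p ih =>
    obtain ⟨j, -, hj⟩ := R.adj_i _ _ h
    have hsub : diffSet (R.i a) (R.i b) ⊆ insert j (diffSet (R.i c) (R.i b)) := by
      intro k hk
      by_cases hkj : k = j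
      · exact Or.inl hkj
      · exact Or.inr (by simpa [hj k hkj] using hk)
    refine ⟨(ih.1.insert j).subset hsub, ?_⟩
    have h1 := Set.ncard_le_ncard hsub (ih.1.insert j)
    have h2 := Set.ncard_insert_le j (diffSet (R.i c) (R.i b))
    have h3 := ih.2
    rw [SimpleGraph.Walk.length_cons]
    omega

lemma diffSet_finite (a b : V) : (diffSet (R.i a) (R.i b)).Finite :=
  (R.diffSet_finite_and_ncard_le (R.connected a b).some).1

/-- Change the coordinates one at a time. Finiteness is essential, since `ncard` of an infinite set
is 0. -/
lemma dist_r_le {p q : ∀ j, κ j} (h : (diffSet p q).Finite) :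
    X.dist (R.r p) (R.r q) ≤ (diffSet p q).ncard := by
  classical
  generalize hn : (diffSet p q).ncard = n
  induction n generalizing p with
  | zero =>
    rw [Set.ncard_eq_zero h] at hn
    have hpq : p = q := by
      funext j
      by_contra hj
      exact (hn ▸ (show j ∈ diffSet p q from hj) : j ∈ (∅ : Set ι))
    simp [hpq]
  | succ n ih =>
    obtain ⟨j, hj⟩ : (diffSet p q).Nonempty := by
      rw [← Set.ncard_pos h]
      omega
    have hd : diffSet (Function.update p j (q j)) q = diffSet p q \ {j} := by
      ext k
      by_cases hk : k = j
      · subst hk; simp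
      · simp [hk]
    have hc := Set.ncard_sdiff_singleton_add_one hj h
    have h1 := ih (p := Function.update p j (q j)) (by rw [hd]; exact h.sdiff) (by rw [hd]; omega)
    have h2 : X.dist (R.r p) (R.r (Function.update p j (q j))) ≤ 1 := by
      rcases R.adj_r p (Function.update p j (q j))
        ⟨j, by simpa using hj, fun k hk => by simp [hk]⟩ with h | h
      · simp [h]
      · exact (SimpleGraph.dist_eq_one_iff_adj.2 h).le
    have h3 := R.connected.dist_triangle (u := R.r p) (v := R.r (Function.update p j (q j)))
      (w := R.r q)
    omega

lemma dist_eq_ncard (a b : V) : X.dist a b = (diffSet (R.i a) (R.i b)).ncard := by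
  refine le_antisymm ?_ ?_
  · simpa only [R.r_i] using R.dist_r_le (R.diffSet_finite a b)
  · obtain ⟨p, hp⟩ := R.connected.exists_walk_length_eq_dist a b
    exact hp ▸ (R.diffSet_finite_and_ncard_le p).2

/-- Otherwise coordinate `j` changes on both halves and is counted twice. -/
lemma eq_or_eq_of_dist_add_dist {a g z : V} (h : X.dist a g + X.dist g z = X.dist a z) (j : ι) :
    R.i g j = R.i a j ∨ R.i g j = R.i z j := by
  by_contra! hj
  have hf1 := R.diffSet_finite a g
  have hf2 := R.diffSet_finite g z
  have hsub : diffSet (R.i a) (R.i z) ⊆ diffSet (R.i a) (R.i g) ∪ diffSet (R.i g) (R.i z) := by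
    intro k hk
    by_cases hag : R.i a k = R.i g k
    · exact Or.inr (by simpa [← hag] using hk)
    · exact Or.inl hag
  have h1 := Set.ncard_le_ncard hsub (hf1.union hf2)
  have h2 := Set.ncard_union_add_ncard_inter _ _ hf1 hf2
  have h3 : 0 < (diffSet (R.i a) (R.i g) ∩ diffSet (R.i g) (R.i z)).ncard :=
    (Set.ncard_pos (hf1.inter_of_left _)).2 ⟨j, hj.1.symm, hj.2⟩
  simp only [R.dist_eq_ncard] at h
  omega

/-- A retract of a Hamming graph is closed under the dual discriminator of each coordinate, and the
resulting vertex lies between the first two arguments. -/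
lemma exists_dualDiscriminator (x y u : V) :
    ∃ v, X.dist x v + X.dist v y = X.dist x y ∧
      ∀ j, (R.i u j = R.i x j → R.i v j = R.i x j) ∧ (R.i u j ≠ R.i x j → R.i v j = R.i y j) := by
  classical
  set w : ∀ j, κ j := fun j => if R.i u j = R.i x j then R.i x j else R.i y j with hw
  have hwx : ∀ j, R.i u j = R.i x j → w j = R.i x j := fun j h => if_pos h
  have hwy : ∀ j, R.i u j ≠ R.i x j → w j = R.i y j := fun j h => if_neg h
  have hxy := R.diffSet_finite x y
  have hunion : diffSet (R.i x) w ∪ diffSet w (R.i y) = diffSet (R.i x) (R.i y) := by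
    ext j
    by_cases hj : R.i u j = R.i x j
    · simp [hwx j hj]
    · simp [hwy j hj]
  have hdisj : Disjoint (diffSet (R.i x) w) (diffSet w (R.i y)) := by
    rw [Set.disjoint_left]
    intro j h1 h2
    by_cases hj : R.i u j = R.i x j
    · exact h1 (hwx j hj).symm
    · exact h2 (hwy j hj)
  have hf1 : (diffSet (R.i x) w).Finite := hxy.subset (hunion ▸ Set.subset_union_left)
  have hf2 : (diffSet w (R.i y)).Finite := hxy.subset (hunion ▸ Set.subset_union_right)
  have hf3 : (diffSet (R.i u) w).Finite := by
    refine (R.diffSet_finite u x).subset fun j hj hux => hj ?_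
    rw [hwx j hux, hux]
  have hcard := Set.ncard_union_eq hdisj hf1 hf2
  rw [hunion, ← R.dist_eq_ncard] at hcard
  have h1 := R.dist_r_le hf1
  have h2 := R.dist_r_le hf2
  have h3 := R.dist_r_le hf3
  rw [R.r_i] at h1 h2 h3
  have h4 := R.connected.dist_triangle (u := x) (v := R.r w) (w := y)
  have hsum : X.dist x (R.r w) + X.dist (R.r w) y = X.dist x y := by omega
  have hmem := R.eq_or_eq_of_dist_add_dist hsum
  -- Where `u` differs from `w`, it differs from both `x` and `y`, hence from `R.r w`. Since `R.r`
  -- does not increase distances, the two sets have the same size.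
  have hu : diffSet (R.i u) w = diffSet (R.i u) (R.i (R.r w)) := by
    refine Set.eq_of_subset_of_ncard_le ?_ ?_ (R.diffSet_finite _ _)
    · intro j hj
      have hux : R.i u j ≠ R.i x j := fun h => hj (by rw [hwx j h, h])
      have huy : R.i u j ≠ R.i y j := fun h => hj (by rw [hwy j hux, h])
      rcases hmem j with h | h <;> simpa [h]
    · rwa [← R.dist_eq_ncard]
  have hvx : ∀ j, R.i u j = R.i x j → R.i (R.r w) j = R.i x j := by
    intro j hj
    have : j ∉ diffSet (R.i u) (R.i (R.r w)) := by
      rw [← hu]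
      simp [hwx j hj, hj]
    rw [← hj]
    simpa [eq_comm] using this
  have hx : diffSet (R.i x) (R.i (R.r w)) = diffSet (R.i x) w := by
    refine Set.eq_of_subset_of_ncard_le ?_ ?_ hf1
    · intro j hj
      have hux : R.i u j ≠ R.i x j := fun h => hj (hvx j h).symm
      rcases hmem j with h | h
      · exact absurd h.symm hj
      · rw [mem_diffSet, h] at hj
        rwa [mem_diffSet, hwy j hux]
    · rw [← R.dist_eq_ncard]
      omega
  refine ⟨R.r w, hsum, fun j => ⟨hvx j, fun hj => ?_⟩⟩
  rcases hmem j with h | h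
  · have : j ∉ diffSet (R.i x) w := by
      rw [← hx]
      simp [h]
    rw [h, ← hwy j hj]
    simpa using this
  · exact h

/-! ### Hyperplanes, sectors and parallelism -/

/-- All the edges of a hyperplane change a common coordinate. -/
lemma exists_coordinate {J : Set (Sym2 V)} (hJ : IsHyperplane X J) :
    ∃ j, ∀ a b, s(a, b) ∈ J → R.i a j ≠ R.i b j := by
  obtain ⟨e, he, rfl⟩ := hJ
  induction e using Sym2.ind with
  | _ a₀ b₀ =>
  obtain ⟨j, hj, -⟩ := R.adj_i _ _ ((SimpleGraph.mem_edgeSet X).1 he)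
  have only : ∀ {a b}, X.Adj a b → R.i a j ≠ R.i b j → ∀ k, k ≠ j → R.i a k = R.i b k := by
    intro a b hab hne k hk
    obtain ⟨l, -, hl⟩ := R.adj_i _ _ hab
    have : j = l := by
      by_contra h
      exact hne (hl j h)
    exact hl k (this ▸ hk)
  have key : ∀ f, Relation.ReflTransGen (EdgeRel X) s(a₀, b₀) f →
      ∀ a b, f = s(a, b) → R.i a j ≠ R.i b j := by
    intro f hf
    induction hf with
    | refl =>
      intro a b hab
      rcases Sym2.eq_iff.1 hab with ⟨rfl, rfl⟩ | ⟨rfl, rfl⟩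
      · exact hj
      · exact hj.symm
    | tail _ hstep ih =>
      rcases hstep with ⟨a, b, c, hab, hbc, hca, he, hf⟩ |
        ⟨a, b, c, d, hab, hbc, hcd, hda, hac, hbd, hac', hbd', he, hf⟩
      · have hne := ih a b he
        have hbc' : R.i b j ≠ R.i c j := by
          intro hbcj
          have h1 := only hca (by rw [← hbcj]; exact hne.symm)
          have h2 := only hab hne
          exact hbc.ne (R.ext_i fun k => by
            by_cases hk : k = j
            · exact hk ▸ hbcj
            · rw [← h2 k hk, h1 k hk])
        intro x y hxy
        rcases Sym2.eq_iff.1 (hf.symm.trans hxy) with ⟨rfl, rfl⟩ | ⟨rfl, rfl⟩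
        · exact hbc'
        · exact hbc'.symm
      · have hne := ih a b he
        have h1 := only hab hne
        -- Otherwise another side changes `j`, and the ends of a diagonal differ at most in
        -- coordinate `j`, so the 4-cycle is not induced.
        have hcd' : R.i c j ≠ R.i d j := by
          intro hcdj
          by_cases hbcj : R.i b j = R.i c j
          · have h2 := only hda (by rw [← hcdj, ← hbcj]; exact hne.symm)
            rcases R.eq_or_adj (a := b) (b := d) fun k hk => by rw [← h1 k hk, h2 k hk] with h | h
            · exact hbd h
            · exact hbd' h
          · have h2 := only hbc hbcj
            rcases R.eq_or_adj (a := a) (b := c) fun k hk => by rw [h1 k hk, h2 k hk] with h | h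
            · exact hac h
            · exact hac' h
        intro x y hxy
        rcases Sym2.eq_iff.1 (hf.symm.trans hxy) with ⟨rfl, rfl⟩ | ⟨rfl, rfl⟩
        · exact hcd'
        · exact hcd'.symm
  exact ⟨j, fun a b h => key _ h a b rfl⟩

/-- A geodesic between vertices with the same `j`-coordinate never changes it, so it avoids `J`. -/
lemma reachable_deleteEdges {J : Set (Sym2 V)} {j : ι}
    (hJ : ∀ a b, s(a, b) ∈ J → R.i a j ≠ R.i b j) {a b : V} (hab : R.i a j = R.i b j) :
    (X.deleteEdges J).Reachable a b := by
  generalize hn : X.dist a b = n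
  obtain ⟨p, hp⟩ := R.connected.exists_walk_length_eq_dist a b
  rw [hn] at hp
  induction n generalizing a with
  | zero => rw [SimpleGraph.Walk.eq_of_length_eq_zero hp]
  | succ n ih =>
    cases p with
    | nil => simp at hp
    | @cons _ c _ h p =>
      rw [SimpleGraph.Walk.length_cons] at hp
      have h1 : X.dist a c = 1 := SimpleGraph.dist_eq_one_iff_adj.2 h
      have h2 := SimpleGraph.dist_le p
      have h3 := R.connected.dist_triangle (u := a) (v := c) (w := b)
      have hac : R.i a j = R.i c j := by
        rcases R.eq_or_eq_of_dist_add_dist (a := a) (g := c) (z := b) (by omega) j with h | h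
        · exact h.symm
        · exact hab.trans h.symm
      have hadj : (X.deleteEdges J).Adj a c :=
        SimpleGraph.deleteEdges_adj.2 ⟨h, fun hmem => hJ _ _ hmem hac⟩
      exact hadj.reachable.trans (ih (hac.symm.trans hab) (by omega) p (by omega))

/-- Every sector is a union of fibres of some coordinate. -/
lemma exists_coordinate_of_isSector {S : Set V} (hS : IsSector X S) :
    ∃ j, ∀ a b, R.i a j = R.i b j → (a ∈ S ↔ b ∈ S) := by
  obtain ⟨J, hJ, c, rfl⟩ := hS
  obtain ⟨j, hj⟩ := R.exists_coordinate hJ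
  refine ⟨j, fun a b hab => ?_⟩
  have := SimpleGraph.ConnectedComponent.eq.2 (R.reachable_deleteEdges hj hab)
  rw [SimpleGraph.ConnectedComponent.mem_supp_iff, SimpleGraph.ConnectedComponent.mem_supp_iff,
    this]

lemma parallel_of_coordinates {a b x y : V}
    (h : ∀ j, (R.i a j = R.i x j ∧ R.i b j = R.i y j) ∨
      (R.i a j = R.i b j ∧ R.i x j = R.i y j)) : Parallel X a b x y := by
  intro S hS
  obtain ⟨j, hj⟩ := R.exists_coordinate_of_isSector hS
  rcases h j with ⟨h1, h2⟩ | ⟨h1, h2⟩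
  · rw [hj _ _ h1, hj _ _ h2]
  · rw [hj _ _ h1, hj _ _ h2]
    tauto

/-! ### Gates and the cone-off -/

/-- The gate of `x` has the same coordinate as `x` wherever the gated subgraph is not constant. -/
lemma exists_gate {P : X.Subgraph} (hP : IsGated P) (x : V) :
    ∃ g ∈ P.verts, ∀ j, (∃ u ∈ P.verts, ∃ v ∈ P.verts, R.i u j ≠ R.i v j) →
      R.i g j = R.i x j := by
  obtain ⟨g, ⟨hg, hgeo⟩, -⟩ := hP x
  refine ⟨g, hg, fun j ⟨u, hu, v, hv, huv⟩ => ?_⟩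
  by_contra hne
  -- The gate lies between `x` and every vertex of `P`.
  have hz : ∀ z ∈ P.verts, R.i g j = R.i z j := by
    intro z hz
    obtain ⟨p, hp, hgp⟩ := hgeo z hz
    exact (R.eq_or_eq_of_dist_add_dist (dist_add_dist_of_mem_support hp hgp) j).resolve_left hne
  exact huv ((hz u hu).symm.trans (hz v hv))

/-- A map acting coordinatewise sends the ends of an edge of the cone-off to equal or
adjacent vertices. -/
lemma coneOff_eq_or_adj {𝓒 : Set X.Subgraph} (hgated : ∀ P ∈ 𝓒, IsGated P)
    (hpar : ∀ x y a b : V, Parallel X x y a b →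
      (∃ P ∈ 𝓒, x ∈ P.verts ∧ y ∈ P.verts) → ∃ P ∈ 𝓒, a ∈ P.verts ∧ b ∈ P.verts)
    {φ : V → V} (hφ : ∀ u v j, R.i u j = R.i v j → R.i (φ u) j = R.i (φ v) j) {u v : V}
    (h : (coneOff X (SimpleGraph.Subgraph.verts '' 𝓒)).Adj u v) :
    φ u = φ v ∨ (coneOff X (SimpleGraph.Subgraph.verts '' 𝓒)).Adj (φ u) (φ v) := by
  rcases h with h | ⟨-, _, ⟨P, hP, rfl⟩, hu, hv⟩
  · obtain ⟨j, -, hj⟩ := R.adj_i _ _ h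
    exact (R.eq_or_adj fun k hk => hφ u v k (hj k hk)).imp_right Or.inl
  · obtain ⟨g, hg, hgc⟩ := R.exists_gate (hgated P hP) (φ u)
    obtain ⟨g', hg', hgc'⟩ := R.exists_gate (hgated P hP) (φ v)
    -- The images may leave `P`, but their gates form a parallel pair inside it: in a coordinate
    -- constant on `P`, `u` and `v` agree, hence so do their images.
    have hp : Parallel X g g' (φ u) (φ v) := by
      refine R.parallel_of_coordinates fun j => ?_
      by_cases hj : ∃ u ∈ P.verts, ∃ v ∈ P.verts, R.i u j ≠ R.i v j
      · exact Or.inl ⟨hgc j hj, hgc' j hj⟩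
      · push Not at hj
        exact Or.inr ⟨hj g hg g' hg', hφ u v j (hj u hu v hv)⟩
    obtain ⟨Q, hQ, h1, h2⟩ := hpar _ _ _ _ hp ⟨P, hP, hg, hg'⟩
    by_cases hne : φ u = φ v
    · exact Or.inl hne
    · exact Or.inr (Or.inr ⟨hne, _, ⟨Q, hQ, rfl⟩, h1, h2⟩)

end HammingRetraction

lemma exists_walk_map_length_le {Z : SimpleGraph V} {φ : V → V}
    (hφ : ∀ u v, Z.Adj u v → φ u = φ v ∨ Z.Adj (φ u) (φ v)) {u v : V} (p : Z.Walk u v) :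
    ∃ q : Z.Walk (φ u) (φ v), q.length ≤ p.length := by
  induction p with
  | nil => exact ⟨.nil, le_rfl⟩
  | cons h p ih =>
    obtain ⟨q, hq⟩ := ih
    rcases hφ _ _ h with h | h
    · exact ⟨q.copy h.symm rfl, by simp; omega⟩
    · exact ⟨.cons h q, by simpa using hq⟩

end QuasiMedian

open QuasiMedian in
theorem mainTheorem11 {V : Type u} (X : SimpleGraph V) (hX : QuasiMedian.IsQuasiMedian X)
    (𝓒 : Set X.Subgraph) (hgated : ∀ P ∈ 𝓒, QuasiMedian.IsGated P)
    (hpar : ∀ x y a b : V, QuasiMedian.Parallel X x y a b →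
      (∃ P ∈ 𝓒, x ∈ P.verts ∧ y ∈ P.verts) → ∃ P ∈ 𝓒, a ∈ P.verts ∧ b ∈ P.verts) :
    QuasiMedian.IsSyllabic X 𝓒 := by
  obtain ⟨hconn, ι, κ, i, r, hi, hr, hri⟩ := hX
  have R : HammingRetraction X κ := ⟨hconn, i, r, hi, hr, hri⟩
  set Z := coneOff X (SimpleGraph.Subgraph.verts '' 𝓒)
  have hZconn : Z.Connected := hconn.mono fun _ _ h => Or.inl h
  intro x y
  generalize hn : Z.dist x y = n
  induction n generalizing x with
  | zero =>
    obtain rfl := hZconn.dist_eq_zero_iff.1 hn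
    exact ⟨.nil, by simp [IsGeodesic], .nil, .nil x, by simp [IsGeodesic]⟩
  | succ n ih =>
    choose φ hbetween hφ using R.exists_dualDiscriminator y x
    have hcoord : ∀ u v j, R.i u j = R.i v j → R.i (φ u) j = R.i (φ v) j := by
      intro u v j huv
      by_cases h : R.i u j = R.i y j
      · rw [(hφ u j).1 h, (hφ v j).1 (huv ▸ h)]
      · rw [(hφ u j).2 h, (hφ v j).2 (huv ▸ h)]
    have hφx : φ x = x := R.ext_i fun j => by
      by_cases h : R.i x j = R.i y j
      · rw [(hφ x j).1 h, h]
      · exact (hφ x j).2 h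
    have hφy : φ y = y := R.ext_i fun j => (hφ y j).1 rfl
    have hcontr : ∀ u v, Z.Adj u v → φ u = φ v ∨ Z.Adj (φ u) (φ v) := fun u v h =>
      R.coneOff_eq_or_adj hgated hpar hcoord h
    obtain ⟨p, hp⟩ := hZconn.exists_walk_length_eq_dist x y
    rw [hn] at hp
    cases p with
    | nil => simp at hp
    | @cons _ u _ h p =>
      rw [SimpleGraph.Walk.length_cons] at hp
      obtain ⟨q, hq⟩ := exists_walk_map_length_le hcontr p
      have hle : Z.dist (φ u) (φ y) ≤ n := (SimpleGraph.dist_le q).trans (by omega)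
      rw [hφy] at hle
      have hadj : Z.Adj x (φ u) := by
        have h' := hcontr _ _ h
        rw [hφx] at h'
        -- If `φ u = x`, then `x` is within cone-off distance `n` of `y`, against `hn`.
        refine h'.resolve_left fun hxu => ?_
        rw [← hxu] at hle
        omega
      have h1 : Z.dist x (φ u) = 1 := SimpleGraph.dist_eq_one_iff_adj.2 hadj
      have h2 := hZconn.dist_triangle (u := x) (v := φ u) (w := y)
      have hdist : Z.dist (φ u) y = n := by omega
      obtain ⟨γ, hγ, δ, hext, hδ⟩ := ih (φ u) hdist
      obtain ⟨s, hs⟩ := hconn.exists_walk_length_eq_dist x (φ u)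
      refine ⟨.cons hadj γ, ?_, s.append δ, .cons hadj γ s δ hs hext, ?_⟩
      · rw [IsGeodesic, SimpleGraph.Walk.length_cons, hγ, hdist, hn]
      · have hb := hbetween u
        rw [SimpleGraph.dist_comm (u := y) (v := φ u), SimpleGraph.dist_comm (u := φ u) (v := x),
          SimpleGraph.dist_comm (u := y) (v := x)] at hb
        rw [IsGeodesic, SimpleGraph.Walk.length_append, hs, hδ]
        omega
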